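/- Let $\varrho>1$, let $\mathcal{E}_\varrho$ be the Bernstein ellipse, i.e. the image of the circle $|z|=\varrho$ under $z\mapsto (z+z^{-1})/2$, and let $f$ be a complex-valued function that is analytic in the open region inside $\mathcal{E}_\varrho$ and satisfies $|f|\le M$ there. Let $w$ be a weight function on $(-1,1)$: integrable, nonnegative almost everywhere, with $\int_{-1}^1 w(x)\,dx>0$. Let $Q\ge 1$ be an integer. A $Q$-point Gauss quadrature formula for $w$ is $I_Qf=\sum_{j=1}^Q w_jf(x_j)$ with real nodes $x_1<\dots<x_Q$ such that $\prod_{j}(x-x_j)$ is orthogonal to all polynomials of degree less than $Q$ with respect to $w(x)\,dx$ on $[-1,1]$, and with weights $w_j=\int_{-1}^1 w(x)\ell_j(x)\,dx$, where $\ell_j$ are the Lagrange basis polynomials of the nodes. Then such a formula exists, and every such formula has its nodes in $(-1,1)$ and weights $w_j>0$, and, with $If=\int_{-1}^1 w(x)f(x)\,dx$, \[ |If-I_Qf|\le 4M\,\frac{\varrho^{-2Q+1}}{\varrho-1}\int_{-1}^1 w(x)\,dx . \] -/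

import Mathlib

open Polynomial

/-- The Bernstein ellipse (a curve): the image of the circle of radius `ρ` around `0` under
`z ↦ (z + z⁻¹) / 2`. -/
def bernsteinEllipse (ρ : ℝ) : Set ℂ :=
  (fun z : ℂ => (z + z⁻¹) / 2) '' Metric.sphere (0 : ℂ) ρ

/-- The open region inside the Bernstein ellipse, which has the semi-axes `(ρ + ρ⁻¹) / 2` (real
direction) and `(ρ - ρ⁻¹) / 2` (imaginary direction). -/
def insideBernsteinEllipse (ρ : ℝ) : Set ℂ :=
  {z : ℂ | (z.re / ((ρ + ρ⁻¹) / 2)) ^ 2 + (z.im / ((ρ - ρ⁻¹) / 2)) ^ 2 < 1}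

/-- The curve `bernsteinEllipse ρ` is the boundary ellipse of `insideBernsteinEllipse ρ`. -/
theorem mem_bernsteinEllipse_iff {ρ : ℝ} (hρ : 1 < ρ) (z : ℂ) :
    z ∈ bernsteinEllipse ρ ↔
      (z.re / ((ρ + ρ⁻¹) / 2)) ^ 2 + (z.im / ((ρ - ρ⁻¹) / 2)) ^ 2 = 1 := by
  have h0 : 0 < ρ := by linarith
  have hinv : ρ⁻¹ < 1 := inv_lt_one_of_one_lt₀ hρ
  have hipos : 0 < ρ⁻¹ := inv_pos.mpr h0
  have ha : (ρ + ρ⁻¹) / 2 ≠ 0 := by positivity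
  have hb : (ρ - ρ⁻¹) / 2 ≠ 0 := by
    have : 0 < ρ - ρ⁻¹ := by linarith
    positivity
  have key : ∀ u : ℂ, u.re ^ 2 + u.im ^ 2 = ρ ^ 2 →
      ((u + u⁻¹) / 2).re = (ρ + ρ⁻¹) / 2 * (u.re / ρ) ∧
      ((u + u⁻¹) / 2).im = (ρ - ρ⁻¹) / 2 * (u.im / ρ) := by
    intro u hu
    have hn : Complex.normSq u = ρ ^ 2 := by rw [Complex.normSq_apply, ← hu]; ring
    have h2 : (2 : ℂ) = ((2 : ℝ) : ℂ) := by norm_num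
    constructor
    · rw [h2, Complex.div_ofReal_re, Complex.add_re, Complex.inv_re, hn]
      field_simp
    · rw [h2, Complex.div_ofReal_im, Complex.add_im, Complex.inv_im, hn]
      field_simp
      ring
  have hs : ∀ u : ℂ, u ∈ Metric.sphere (0 : ℂ) ρ ↔ u.re ^ 2 + u.im ^ 2 = ρ ^ 2 := by
    intro u
    rw [mem_sphere_zero_iff_norm, ← sq_eq_sq₀ (norm_nonneg u) h0.le, Complex.sq_norm,
      Complex.normSq_apply, ← sq, ← sq]
  constructor
  · rintro ⟨u, hu, rfl⟩
    have hu' := (hs u).1 hu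
    obtain ⟨h1, h2⟩ := key u hu'
    simp only [h1, h2]
    rw [mul_div_cancel_left₀ _ ha, mul_div_cancel_left₀ _ hb, div_pow, div_pow, ← add_div, hu']
    exact div_self (by positivity)
  · intro hz
    have hu' : (⟨ρ * (z.re / ((ρ + ρ⁻¹) / 2)), ρ * (z.im / ((ρ - ρ⁻¹) / 2))⟩ : ℂ).re ^ 2 +
        (⟨ρ * (z.re / ((ρ + ρ⁻¹) / 2)), ρ * (z.im / ((ρ - ρ⁻¹) / 2))⟩ : ℂ).im ^ 2 = ρ ^ 2 := by
      simp only [mul_pow, ← mul_add, hz, mul_one]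
    refine ⟨_, (hs _).2 hu', ?_⟩
    obtain ⟨h1, h2⟩ := key _ hu'
    apply Complex.ext
    · rw [h1]
      simp only [mul_div_cancel_left₀ _ h0.ne', mul_div_cancel₀ _ ha]
    · rw [h2]
      simp only [mul_div_cancel_left₀ _ h0.ne', mul_div_cancel₀ _ hb]

/-- `w` is a weight function on `(-1, 1)`: integrable, nonnegative almost everywhere, and of
positive total mass (it need not be bounded, so that Jacobi weights are included). -/
structure IsWeight (w : ℝ → ℝ) : Prop where
  integrable : IntervalIntegrable w MeasureTheory.volume (-1) 1
  nonneg : ∀ᵐ t ∂(MeasureTheory.volume.restrict (Set.Ioo (-1 : ℝ) 1)), 0 ≤ w t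
  mass_pos : 0 < ∫ t in (-1 : ℝ)..1, w t

/-- `x` and `c` are the nodes and the weights of the `Q`-point Gauss quadrature formula on `[-1, 1]`
for the weight function `w`: the nodes, listed in increasing order, are the zeros of the `Q`-th
orthogonal polynomial for `w` (the monic polynomial `∏ j, (X - x j)` of degree `Q` is
orthogonal to all polynomials of smaller degree), and the weights are those of the interpolatory
formula, that is, the weighted integrals of the Lagrange basis polynomials of the nodes. -/
structure IsGaussRule (w : ℝ → ℝ) (Q : ℕ) (x c : Fin Q → ℝ) : Prop where
  strictMono : StrictMono x
  orthogonal : ∀ q : ℝ[X], q.degree < (Q : WithBot ℕ) →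
    ∫ t in (-1 : ℝ)..1, w t * ((∏ j, (X - C (x j))).eval t * q.eval t) = 0
  weight_eq : ∀ j, c j = ∫ t in (-1 : ℝ)..1, w t * (Lagrange.basis Finset.univ x j).eval t

/-!
The Gauss rule with `Q` nodes is exact on polynomials of degree less than `2 * Q` and has positive
weights, so its error at `f` is at most `2 * ∫ w` times the uniform distance on `[-1, 1]` from `f`
to any such polynomial. We take a partial sum of the Chebyshev series of `f`. Under the substitution
`x = (z + z⁻¹) / 2` this series becomes the Laurent series of `f ((z + z⁻¹) / 2)`, which is analytic
for `1 ≤ |z| < ρ`; moving the circle of integration from radius `1` towards `ρ` bounds the `k`-th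
Chebyshev coefficient by `2 * M * ρ ^ (-k)`, and the tail of the series is dominated by a geometric
one.
-/

/-! ### Quadrature for positive functionals -/

/-- The functional `L` is strictly positive on the nonzero polynomials that are nonnegative on `s`.
Integration against a weight on `(-1, 1)` has this property for `s = (-1, 1)`. -/
def IsPositiveOn {K : Type*} [CommRing K] [LinearOrder K] (L : K[X] →ₗ[K] K) (s : Set K) : Prop :=
  ∀ p : K[X], p ≠ 0 → (∀ t ∈ s, 0 ≤ p.eval t) → 0 < L p

/-- The polynomial `P` is orthogonal, for the bilinear form `(p, q) ↦ L (p * q)`, to every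
polynomial of degree less than `n`. The degree of `P` itself is left free. -/
def IsOrthogonalBelow {K : Type*} [CommRing K] (L : K[X] →ₗ[K] K) (n : ℕ) (P : K[X]) : Prop :=
  ∀ q : K[X], q.degree < n → L (P * q) = 0

theorem exists_monic_isOrthogonalBelow {K : Type*} [Field K] {L : K[X] →ₗ[K] K}
    (hL : ∀ p, p ≠ 0 → L (p * p) ≠ 0) (n : ℕ) :
    ∃ P : K[X], P.Monic ∧ P.natDegree = n ∧ IsOrthogonalBelow L n P := by
  let form : K[X] →ₗ[K] K[X] →ₗ[K] K := (LinearMap.mul K K[X]).compr₂ L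
  let gram : degreeLT K n →ₗ[K] Module.Dual K (degreeLT K n) :=
    form.domRestrict₁₂ (degreeLT K n) (degreeLT K n)
  have gram_injective : Function.Injective gram := by
    rw [injective_iff_map_eq_zero]
    intro p hp
    by_contra hne
    exact hL p (by simpa using hne) (LinearMap.congr_fun hp p)
  have : FiniteDimensional K (degreeLT K n) := (degreeLTEquiv K n).symm.finiteDimensional
  have gram_surjective : Function.Surjective gram :=
    (LinearMap.injective_iff_surjective_of_finrank_eq_finrank
      Subspace.dual_finrank_eq.symm).1 gram_injective
  obtain ⟨r, hr⟩ := gram_surjective ((form (X ^ n)).domRestrict (degreeLT K n))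
  have hdeg : (r : K[X]).degree < (X ^ n : K[X]).degree := by
    rw [degree_X_pow]
    exact mem_degreeLT.1 r.2
  refine ⟨X ^ n - (r : K[X]), (monic_X_pow n).sub_of_left hdeg, ?_, fun q hq => ?_⟩
  · refine natDegree_eq_of_degree_eq_some ?_
    rw [degree_sub_eq_left_of_degree_lt hdeg, degree_X_pow]
  · rw [sub_mul, map_sub, sub_eq_zero]
    exact (LinearMap.congr_fun hr ⟨q, mem_degreeLT.2 hq⟩).symm

theorem exists_finset_isSquare_prod_map_mul_prod {α M : Type*} [DecidableEq α] [CommMonoid M]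
    (f : α → M) (m : Multiset α) :
    ∃ S ⊆ m.toFinset, IsSquare ((m.map f).prod * ∏ a ∈ S, f a) := by
  induction m using Multiset.induction_on with
  | empty => exact ⟨∅, by simp⟩
  | cons a m ih =>
    obtain ⟨S, hS, hsq⟩ := ih
    rw [Multiset.map_cons, Multiset.prod_cons, Multiset.toFinset_cons]
    by_cases ha : a ∈ S
    · refine ⟨S.erase a, (S.erase_subset a).trans (hS.trans (Finset.subset_insert a _)), ?_⟩
      rwa [mul_right_comm, Finset.mul_prod_erase S f ha, mul_comm]
    · refine ⟨insert a S, Finset.insert_subset_insert a hS, ?_⟩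
      rw [Finset.prod_insert ha, mul_mul_mul_comm]
      exact (IsSquare.mul_self (f a)).mul hsq

theorem eval_nonneg_or_eval_nonpos_of_roots_eq_zero {q : ℝ[X]} (hq : q.roots = 0) :
    (∀ t, 0 ≤ q.eval t) ∨ ∀ t, q.eval t ≤ 0 := by
  by_contra! h
  obtain ⟨⟨a, ha⟩, b, hb⟩ := h
  obtain ⟨u, hu⟩ := mem_range_of_exists_le_of_exists_ge q.continuous ⟨a, ha.le⟩ ⟨b, hb.le⟩
  have hq0 : q ≠ 0 := by
    rintro rfl
    simp at hb
  simpa [hq] using (mem_roots hq0).2 hu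

-- `S` consists of the roots of odd multiplicity, across which `P` changes sign.
theorem exists_finset_roots_mul_nodal_constant_sign (P : ℝ[X]) :
    ∃ S ⊆ P.roots.toFinset, (∀ t, 0 ≤ (P * Lagrange.nodal S id).eval t) ∨
      ∀ t, (P * Lagrange.nodal S id).eval t ≤ 0 := by
  obtain ⟨q, hPq, -, hq⟩ := exists_prod_multiset_X_sub_C_mul P
  obtain ⟨S, hS, R, hR⟩ := exists_finset_isSquare_prod_map_mul_prod (fun a => X - C a) P.roots
  have heval : ∀ t, (P * Lagrange.nodal S id).eval t = R.eval t * R.eval t * q.eval t := by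
    intro t
    conv_lhs => rw [← hPq]
    rw [← eval_mul, ← eval_mul, ← hR, mul_right_comm, Lagrange.nodal_eq]
    simp only [id_eq]
  refine ⟨S, hS, ?_⟩
  simp only [heval]
  exact (eval_nonneg_or_eval_nonpos_of_roots_eq_zero hq).imp
    (fun h t => mul_nonneg (mul_self_nonneg _) (h t))
    fun h t => mul_nonpos_of_nonneg_of_nonpos (mul_self_nonneg _) (h t)

namespace IsPositiveOn

section LinearOrderedRing

variable {K : Type*} [CommRing K] [LinearOrder K] {L : K[X] →ₗ[K] K} {s t : Set K}

theorem mono (hL : IsPositiveOn L s) (hst : s ⊆ t) : IsPositiveOn L t :=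
  fun p hp hpos => hL p hp fun x hx => hpos x (hst hx)

variable [IsStrictOrderedRing K]

theorem map_mul_self_pos (hL : IsPositiveOn L s) {p : K[X]} (hp : p ≠ 0) : 0 < L (p * p) :=
  hL _ (mul_self_ne_zero.2 hp) fun t _ => by
    rw [eval_mul]
    exact mul_self_nonneg _

theorem map_ne_zero (hL : IsPositiveOn L s) {p : K[X]} (hp : p ≠ 0)
    (hsign : (∀ t ∈ s, 0 ≤ p.eval t) ∨ ∀ t ∈ s, p.eval t ≤ 0) : L p ≠ 0 := by
  rcases hsign with hnonneg | hnonpos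
  · exact (hL p hp hnonneg).ne'
  · have hneg := hL (-p) (neg_ne_zero.2 hp) fun t ht => by simpa using hnonpos t ht
    rw [map_neg, neg_pos] at hneg
    exact hneg.ne

/-- If `x i` were outside `s`, then `nodal * nodal.erase i = (X - x i) * (nodal.erase i) ^ 2` would
not change sign on `s`. -/
theorem node_mem_of_isOrthogonalBelow {ι : Type*} {I : Finset ι}
    {x : ι → K} (hL : IsPositiveOn L s) (hs : s.OrdConnected)
    (horth : IsOrthogonalBelow L I.card (Lagrange.nodal I x)) {i : ι} (hi : i ∈ I) : x i ∈ s := by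
  classical
  by_contra hxi
  set N := Lagrange.nodal (I.erase i) x
  have hdeg : N.degree < I.card := by
    rw [Lagrange.degree_nodal]
    exact_mod_cast Finset.card_erase_lt_of_mem hi
  have hne : Lagrange.nodal I x * N ≠ 0 :=
    mul_ne_zero Lagrange.nodal_ne_zero Lagrange.nodal_ne_zero
  have heval : ∀ t, (Lagrange.nodal I x * N).eval t = (t - x i) * N.eval t ^ 2 := by
    intro t
    rw [Lagrange.nodal_eq_mul_nodal_erase hi]
    simp only [eval_mul, eval_sub, eval_X, eval_C]
    ring
  have hside : (∀ t ∈ s, x i ≤ t) ∨ ∀ t ∈ s, t ≤ x i := by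
    by_contra! h
    obtain ⟨⟨a, has, ha⟩, b, hbs, hb⟩ := h
    exact hxi (hs.out has hbs ⟨ha.le, hb.le⟩)
  refine hL.map_ne_zero hne ?_ (horth N hdeg)
  simp only [heval]
  exact hside.imp (fun h t ht => mul_nonneg (sub_nonneg.2 (h t ht)) (sq_nonneg _))
    fun h t ht => mul_nonpos_of_nonpos_of_nonneg (sub_nonpos.2 (h t ht)) (sq_nonneg _)

end LinearOrderedRing

theorem exists_finset_isOrthogonalBelow_nodal {L : ℝ[X] →ₗ[ℝ] ℝ}
    (hL : IsPositiveOn L Set.univ) (n : ℕ) :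
    ∃ S : Finset ℝ, S.card = n ∧ IsOrthogonalBelow L n (Lagrange.nodal S id) := by
  obtain ⟨P, hmonic, hdeg, horth⟩ :=
    exists_monic_isOrthogonalBelow (fun p hp => (hL.map_mul_self_pos hp).ne') n
  obtain ⟨S, hS, hsign⟩ := exists_finset_roots_mul_nodal_constant_sign P
  have hle : n ≤ S.card := by
    by_contra! hlt
    refine hL.map_ne_zero (mul_ne_zero hmonic.ne_zero Lagrange.nodal_ne_zero) (by simpa using hsign)
      (horth (Lagrange.nodal S id) ?_)
    rw [Lagrange.degree_nodal]
    exact_mod_cast hlt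
  have hdvd : Lagrange.nodal S id ∣ P :=
    (Multiset.prod_X_sub_C_dvd_iff_le_roots hmonic.ne_zero S.val).2
      (Finset.val_le_iff_val_subset.2 fun a ha => Multiset.mem_toFinset.1 (hS ha))
  have hP : P = Lagrange.nodal S id :=
    eq_of_monic_of_dvd_of_natDegree_le Lagrange.nodal_monic hmonic hdvd
      (by rwa [hdeg, Lagrange.natDegree_nodal])
  refine ⟨S, ?_, hP ▸ horth⟩
  rw [← hdeg, hP, Lagrange.natDegree_nodal]

end IsPositiveOn

theorem degree_divByMonic_lt_of_degree_lt_add {R : Type*} [CommRing R] {p q : R[X]} {n : ℕ}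
    (hq : q.Monic) (hp : p.degree < (q.natDegree + n : ℕ)) : (p /ₘ q).degree < n := by
  nontriviality R
  rcases lt_or_ge p.degree q.degree with hlt | hle
  · rw [(divByMonic_eq_zero_iff hq).2 hlt, degree_zero]
    exact WithBot.bot_lt_coe n
  · rw [← degree_add_divByMonic hq hle, degree_eq_natDegree hq.ne_zero, Nat.cast_add] at hp
    exact lt_of_add_lt_add_left hp

namespace IsOrthogonalBelow

variable {K ι : Type*} [Field K] [DecidableEq ι] {L : K[X] →ₗ[K] K} {I : Finset ι} {x : ι → K}

theorem map_eq_sum_basis (horth : IsOrthogonalBelow L I.card (Lagrange.nodal I x))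
    (hx : Set.InjOn x I) {p : K[X]} (hp : p.degree < (2 * I.card : ℕ)) :
    L p = ∑ i ∈ I, L (Lagrange.basis I x i) * p.eval (x i) := by
  set N := Lagrange.nodal I x
  have hmonic : N.Monic := Lagrange.nodal_monic
  have hmod : (p %ₘ N).degree < I.card :=
    (degree_modByMonic_lt p hmonic).trans_eq Lagrange.degree_nodal
  have hdiv : (p /ₘ N).degree < I.card :=
    degree_divByMonic_lt_of_degree_lt_add hmonic (by rwa [Lagrange.natDegree_nodal, ← two_mul])
  have heval : ∀ i ∈ I, (p %ₘ N).eval (x i) = p.eval (x i) := fun i hi => by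
    rw [modByMonic_eq_sub_mul_div p N, eval_sub, eval_mul, Lagrange.eval_nodal_at_node hi,
      zero_mul, sub_zero]
  calc L p = L (p %ₘ N) := by
        rw [← add_zero (L (p %ₘ N)), ← horth _ hdiv, ← map_add, modByMonic_add_div]
    _ = L (Lagrange.interpolate I x fun i => p.eval (x i)) := by
        rw [← Lagrange.eq_interpolate_of_eval_eq _ hx hmod heval]
    _ = ∑ i ∈ I, L (Lagrange.basis I x i) * p.eval (x i) := by
        rw [Lagrange.interpolate_apply, map_sum]
        refine Finset.sum_congr rfl fun i _ => ?_
        rw [← smul_eq_C_mul, map_smul, smul_eq_mul, mul_comm]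

theorem map_basis_pos [LinearOrder K] [IsStrictOrderedRing K] {s : Set K}
    (horth : IsOrthogonalBelow L I.card (Lagrange.nodal I x)) (hx : Set.InjOn x I)
    (hL : IsPositiveOn L s) {i : ι} (hi : i ∈ I) : 0 < L (Lagrange.basis I x i) := by
  set l := Lagrange.basis I x i
  have hdeg : (l * l).degree < (2 * I.card : ℕ) := by
    have := Finset.card_pos.2 ⟨i, hi⟩
    rw [degree_mul, Lagrange.degree_basis hx hi]
    exact_mod_cast (by omega : I.card - 1 + (I.card - 1) < 2 * I.card)
  have hmap : L (l * l) = L l := by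
    rw [horth.map_eq_sum_basis hx hdeg, Finset.sum_eq_single_of_mem i hi fun j hj hji => ?_]
    · rw [eval_mul, Lagrange.eval_basis_self hx hi, mul_one, mul_one]
    · rw [eval_mul, Lagrange.eval_basis_of_ne hji.symm hj, mul_zero, mul_zero]
  exact hmap ▸ hL.map_mul_self_pos (Lagrange.basis_ne_zero hx hi)

end IsOrthogonalBelow

/-! ### Gauss rules for a weight function -/

namespace IsWeight

variable {w : ℝ → ℝ}

theorem ae_nonneg (hw : IsWeight w) :
    ∀ᵐ t ∂MeasureTheory.volume.restrict (Set.Ioc (-1 : ℝ) 1), 0 ≤ w t := by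
  rw [← MeasureTheory.restrict_Ioo_eq_restrict_Ioc]
  exact hw.nonneg

theorem intervalIntegrable_ofReal_mul (hw : IsWeight w) {g : ℝ → ℂ}
    (hg : ContinuousOn g (Set.Icc (-1) 1)) :
    IntervalIntegrable (fun t => (w t : ℂ) * g t) MeasureTheory.volume (-1) 1 := by
  have hwc : IntervalIntegrable (fun t => (w t : ℂ)) MeasureTheory.volume (-1) 1 :=
    ⟨hw.integrable.1.ofReal, hw.integrable.2.ofReal⟩
  exact hwc.mul_continuousOn (by rwa [Set.uIcc_of_le (by norm_num)])

/-- Integration of real polynomials against the weight `w`, as a linear functional. Integrability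
of `w` makes it additive, so the functional takes the proof of `IsWeight w` as an argument. -/
noncomputable def polyIntegral (hw : IsWeight w) : ℝ[X] →ₗ[ℝ] ℝ where
  toFun p := ∫ t in (-1 : ℝ)..1, w t * p.eval t
  map_add' p q := by
    simp only [eval_add, mul_add]
    exact intervalIntegral.integral_add (hw.integrable.mul_continuousOn p.continuous.continuousOn)
      (hw.integrable.mul_continuousOn q.continuous.continuousOn)
  map_smul' a p := by
    simp only [eval_smul, smul_eq_mul, RingHom.id_apply, mul_left_comm _ a,
      intervalIntegral.integral_const_mul]

theorem polyIntegral_apply (hw : IsWeight w) (p : ℝ[X]) :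
    hw.polyIntegral p = ∫ t in (-1 : ℝ)..1, w t * p.eval t := rfl

theorem isPositiveOn_polyIntegral (hw : IsWeight w) :
    IsPositiveOn hw.polyIntegral (Set.Ioo (-1) 1) := by
  intro p hp hpos
  have hle : (-1 : ℝ) ≤ 1 := by norm_num
  have hnonneg : ∀ᵐ t ∂MeasureTheory.volume.restrict (Set.Ioc (-1 : ℝ) 1), 0 ≤ w t * p.eval t := by
    rw [← MeasureTheory.restrict_Ioo_eq_restrict_Ioc]
    filter_upwards [hw.nonneg, MeasureTheory.ae_restrict_mem measurableSet_Ioo] with t hwt ht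
    exact mul_nonneg hwt (hpos t ht)
  have hroots : ∀ᵐ t ∂MeasureTheory.volume.restrict (Set.Ioc (-1 : ℝ) 1), p.eval t ≠ 0 :=
    MeasureTheory.ae_restrict_of_ae
      ((finite_setOfPred_isRoot hp).countable.ae_notMem MeasureTheory.volume)
  refine (intervalIntegral.integral_nonneg_of_ae_restrict hle
    (by rwa [MeasureTheory.restrict_Ioc_eq_restrict_Icc] at hnonneg)).lt_of_ne' fun hzero => ?_
  have hmul : ∀ᵐ t ∂MeasureTheory.volume.restrict (Set.Ioc (-1 : ℝ) 1), w t * p.eval t = 0 :=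
    (intervalIntegral.integral_eq_zero_iff_of_le_of_nonneg_ae hle hnonneg
      (hw.integrable.mul_continuousOn p.continuous.continuousOn)).1 hzero
  refine hw.mass_pos.ne' ((intervalIntegral.integral_eq_zero_iff_of_le_of_nonneg_ae hle
    hw.ae_nonneg hw.integrable).2 ?_)
  filter_upwards [hmul, hroots] with t htmul htroot
  exact (mul_eq_zero.1 htmul).resolve_right htroot

theorem exists_isGaussRule (hw : IsWeight w) (Q : ℕ) : ∃ x c : Fin Q → ℝ, IsGaussRule w Q x c := by
  obtain ⟨S, hcard, horth⟩ :=
    (hw.isPositiveOn_polyIntegral.mono (Set.subset_univ _)).exists_finset_isOrthogonalBelow_nodal Q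
  refine ⟨S.orderEmbOfFin hcard, _, (S.orderEmbOfFin hcard).strictMono, fun q hq => ?_,
    fun j => rfl⟩
  have hprod : ∏ j, (X - C (S.orderEmbOfFin hcard j)) = Lagrange.nodal S id := by
    conv_rhs =>
      rw [Lagrange.nodal_eq, ← Finset.image_orderEmbOfFin_univ S hcard,
        Finset.prod_image (S.orderEmbOfFin hcard).injective.injOn]
    rfl
  simpa only [polyIntegral_apply, eval_mul, hprod] using horth q hq

theorem norm_integral_mul_le (hw : IsWeight w) {g : ℝ → ℂ} {E : ℝ}
    (hg : ∀ t ∈ Set.Icc (-1 : ℝ) 1, ‖g t‖ ≤ E) :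
    ‖∫ t in (-1 : ℝ)..1, (w t : ℂ) * g t‖ ≤ E * ∫ t in (-1 : ℝ)..1, w t := by
  rw [← intervalIntegral.integral_const_mul]
  refine intervalIntegral.norm_integral_le_of_norm_le (by norm_num) ?_ (hw.integrable.const_mul E)
  filter_upwards [(MeasureTheory.ae_restrict_iff' measurableSet_Ioc).1 hw.ae_nonneg] with t hwt ht
  rw [norm_mul, Complex.norm_real, Real.norm_of_nonneg (hwt ht), mul_comm]
  exact mul_le_mul_of_nonneg_right (hg t (Set.Ioc_subset_Icc_self ht)) (hwt ht)

end IsWeight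

namespace IsGaussRule

variable {w : ℝ → ℝ} {Q : ℕ} {x c : Fin Q → ℝ}

theorem isOrthogonalBelow (h : IsGaussRule w Q x c) (hw : IsWeight w) :
    IsOrthogonalBelow hw.polyIntegral (Finset.univ : Finset (Fin Q)).card
      (Lagrange.nodal Finset.univ x) := by
  intro q hq
  rw [Finset.card_fin] at hq
  simpa only [IsWeight.polyIntegral_apply, eval_mul, Lagrange.nodal_eq] using h.orthogonal q hq

theorem mem_Ioo (h : IsGaussRule w Q x c) (hw : IsWeight w) (j : Fin Q) :
    x j ∈ Set.Ioo (-1 : ℝ) 1 :=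
  hw.isPositiveOn_polyIntegral.node_mem_of_isOrthogonalBelow Set.ordConnected_Ioo
    (h.isOrthogonalBelow hw) (Finset.mem_univ j)

theorem weight_pos (h : IsGaussRule w Q x c) (hw : IsWeight w) (j : Fin Q) : 0 < c j := by
  rw [h.weight_eq]
  exact (h.isOrthogonalBelow hw).map_basis_pos h.strictMono.injective.injOn
    hw.isPositiveOn_polyIntegral (Finset.mem_univ j)

theorem integral_mul_eval (h : IsGaussRule w Q x c) (hw : IsWeight w) {p : ℝ[X]}
    (hp : p.degree < (2 * Q : ℕ)) :
    ∫ t in (-1 : ℝ)..1, w t * p.eval t = ∑ j, c j * p.eval (x j) := by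
  simp only [h.weight_eq, ← IsWeight.polyIntegral_apply hw]
  exact (h.isOrthogonalBelow hw).map_eq_sum_basis h.strictMono.injective.injOn
    (by rwa [Finset.card_fin])

theorem integral_mul_eval_complex (h : IsGaussRule w Q x c) (hw : IsWeight w) {p : ℂ[X]}
    (hp : p.degree < (2 * Q : ℕ)) :
    ∫ t in (-1 : ℝ)..1, (w t : ℂ) * p.eval (t : ℂ) = ∑ j, (c j : ℂ) * p.eval (x j : ℂ) := by
  have hmoment : ∀ k ∈ p.support,
      ∫ t in (-1 : ℝ)..1, (w t : ℂ) * (p.coeff k * (t : ℂ) ^ k) =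
        ∑ j, (c j : ℂ) * (p.coeff k * (x j : ℂ) ^ k) := by
    intro k hk
    have hdeg : (X ^ k : ℝ[X]).degree < (2 * Q : ℕ) := by
      rw [degree_X_pow]
      exact (le_degree_of_mem_supp k hk).trans_lt hp
    have hreal := congrArg Complex.ofReal (h.integral_mul_eval hw hdeg)
    rw [← intervalIntegral.integral_ofReal] at hreal
    simp only [mul_left_comm _ (p.coeff k), intervalIntegral.integral_const_mul, ← Finset.mul_sum]
    simpa using congrArg (p.coeff k * ·) hreal
  simp only [eval_eq_sum, sum_def, Finset.mul_sum]
  rw [intervalIntegral.integral_finsetSum fun k _ =>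
    hw.intervalIntegrable_ofReal_mul (by fun_prop), Finset.sum_comm]
  exact Finset.sum_congr rfl hmoment

theorem sum_weights (h : IsGaussRule w Q x c) (hw : IsWeight w) (hQ : 1 ≤ Q) :
    ∑ j, c j = ∫ t in (-1 : ℝ)..1, w t := by
  have hdeg : (1 : ℝ[X]).degree < (2 * Q : ℕ) := by
    rw [degree_one]
    exact_mod_cast (by omega : 0 < 2 * Q)
  simpa only [eval_one, mul_one] using (h.integral_mul_eval hw hdeg).symm

theorem norm_sum_mul_le (h : IsGaussRule w Q x c) (hw : IsWeight w) (hQ : 1 ≤ Q) {g : ℝ → ℂ} {E : ℝ}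
    (hg : ∀ t ∈ Set.Icc (-1 : ℝ) 1, ‖g t‖ ≤ E) :
    ‖∑ j, (c j : ℂ) * g (x j)‖ ≤ E * ∫ t in (-1 : ℝ)..1, w t := by
  rw [← h.sum_weights hw hQ, Finset.mul_sum]
  refine norm_sum_le_of_le _ fun j _ => ?_
  have hc := (h.weight_pos hw j).le
  rw [norm_mul, Complex.norm_real, Real.norm_of_nonneg hc, mul_comm]
  exact mul_le_mul_of_nonneg_right (hg _ (Set.Ioo_subset_Icc_self (h.mem_Ioo hw j))) hc

theorem norm_error_le (h : IsGaussRule w Q x c) (hw : IsWeight w) (hQ : 1 ≤ Q) {g : ℝ → ℂ}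
    (hg : ContinuousOn g (Set.Icc (-1) 1)) {p : ℂ[X]} (hp : p.degree < (2 * Q : ℕ)) {E : ℝ}
    (hE : ∀ t ∈ Set.Icc (-1 : ℝ) 1, ‖g t - p.eval (t : ℂ)‖ ≤ E) :
    ‖(∫ t in (-1 : ℝ)..1, (w t : ℂ) * g t) - ∑ j, (c j : ℂ) * g (x j)‖ ≤
      2 * E * ∫ t in (-1 : ℝ)..1, w t := by
  have hsplit : (∫ t in (-1 : ℝ)..1, (w t : ℂ) * g t) - ∑ j, (c j : ℂ) * g (x j) =
      (∫ t in (-1 : ℝ)..1, (w t : ℂ) * (g t - p.eval (t : ℂ))) -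
        ∑ j, (c j : ℂ) * (g (x j) - p.eval (x j : ℂ)) := by
    simp only [mul_sub, Finset.sum_sub_distrib]
    rw [intervalIntegral.integral_sub (hw.intervalIntegrable_ofReal_mul hg)
      (hw.intervalIntegrable_ofReal_mul (by fun_prop)), h.integral_mul_eval_complex hw hp,
      sub_sub_sub_cancel_right]
  calc _ ≤ E * (∫ t in (-1 : ℝ)..1, w t) + E * ∫ t in (-1 : ℝ)..1, w t := by
        rw [hsplit]
        exact norm_sub_le_of_le (hw.norm_integral_mul_le hE) (h.norm_sum_mul_le hw hQ hE)
    _ = 2 * E * ∫ t in (-1 : ℝ)..1, w t := by ring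

end IsGaussRule

/-! ### Joukowski map and Fourier coefficients -/

/-- The Joukowski map. It maps the circle of radius `ρ` onto `bernsteinEllipse ρ` and the unit
circle onto `[-1, 1]`. -/
noncomputable def joukowski (z : ℂ) : ℂ := (z + z⁻¹) / 2

theorem joukowski_inv (z : ℂ) : joukowski z⁻¹ = joukowski z := by
  rw [joukowski, joukowski, inv_inv, add_comm]

theorem differentiableAt_joukowski {z : ℂ} (hz : z ≠ 0) : DifferentiableAt ℂ joukowski z :=
  (differentiableAt_id.add (differentiableAt_inv hz)).div_const 2

theorem joukowski_re (z : ℂ) : (joukowski z).re = (‖z‖ + ‖z‖⁻¹) / 2 * (z.re / ‖z‖) := by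
  rcases eq_or_ne z 0 with rfl | hz
  · simp [joukowski]
  have hnorm : ‖z‖ ≠ 0 := norm_ne_zero_iff.2 hz
  rw [joukowski, Complex.div_ofNat_re, Complex.add_re, Complex.inv_re, Complex.normSq_eq_norm_sq]
  field_simp

theorem joukowski_im (z : ℂ) : (joukowski z).im = (‖z‖ - ‖z‖⁻¹) / 2 * (z.im / ‖z‖) := by
  rcases eq_or_ne z 0 with rfl | hz
  · simp [joukowski]
  have hnorm : ‖z‖ ≠ 0 := norm_ne_zero_iff.2 hz
  rw [joukowski, Complex.div_ofNat_im, Complex.add_im, Complex.inv_im, Complex.normSq_eq_norm_sq]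
  field_simp
  ring

theorem joukowski_coe_circle (z : Circle) : joukowski z = (((z : ℂ).re : ℝ) : ℂ) := by
  rw [joukowski, ← Circle.coe_inv, Circle.coe_inv_eq_conj, Complex.add_conj]
  simp

theorem exists_circle_joukowski_eq {x : ℝ} (hx : x ∈ Set.Icc (-1 : ℝ) 1) :
    ∃ z : Circle, joukowski z = x := by
  refine ⟨Circle.exp (Real.arccos x), ?_⟩
  rw [joukowski_coe_circle, Circle.coe_exp, Complex.exp_ofReal_mul_I_re,
    Real.cos_arccos hx.1 hx.2]

theorem strictMonoOn_add_inv : StrictMonoOn (fun s : ℝ => s + s⁻¹) (Set.Ici 1) := by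
  intro s (hs : 1 ≤ s) t (ht : 1 ≤ t) hst
  have hs0 : s ≠ 0 := by positivity
  have ht0 : t ≠ 0 := by positivity
  have hdiff : t + t⁻¹ - (s + s⁻¹) = (t - s) * (s * t - 1) / (s * t) := by
    field_simp
    ring
  have hst1 : 1 < s * t := one_lt_mul_of_le_of_lt hs (hs.trans_lt hst)
  have hpos : 0 < (t - s) * (s * t - 1) / (s * t) :=
    div_pos (mul_pos (sub_pos.2 hst) (sub_pos.2 hst1)) (one_pos.trans hst1)
  exact sub_pos.1 (hdiff ▸ hpos)

-- The scaled coordinates of `joukowski z` are those of `z / ‖z‖` times factors below `1`.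
theorem joukowski_mem_insideBernsteinEllipse {ρ : ℝ} {z : ℂ} (hz : 1 ≤ ‖z‖) (hρ : ‖z‖ < ρ) :
    joukowski z ∈ insideBernsteinEllipse ρ := by
  have hz0 : 0 < ‖z‖ := one_pos.trans_le hz
  have hρ0 : 0 < ρ := hz0.trans hρ
  have hsum : ‖z‖ + ‖z‖⁻¹ < ρ + ρ⁻¹ := strictMonoOn_add_inv hz (hz.trans hρ.le) hρ
  have hdiff : ‖z‖ - ‖z‖⁻¹ < ρ - ρ⁻¹ := sub_lt_sub hρ (inv_strictAnti₀ hz0 hρ)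
  have hdiff0 : 0 ≤ ‖z‖ - ‖z‖⁻¹ := sub_nonneg.2 ((inv_le_one_of_one_le₀ hz).trans hz)
  have hre : ((‖z‖ + ‖z‖⁻¹) / 2 / ((ρ + ρ⁻¹) / 2)) ^ 2 < 1 := by
    rw [div_div_div_cancel_right₀ two_ne_zero]
    exact pow_lt_one₀ (by positivity) ((div_lt_one (by positivity)).2 hsum) two_ne_zero
  have him : ((‖z‖ - ‖z‖⁻¹) / 2 / ((ρ - ρ⁻¹) / 2)) ^ 2 < 1 := by
    have hpos : 0 < ρ - ρ⁻¹ := hdiff0.trans_lt hdiff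
    rw [div_div_div_cancel_right₀ two_ne_zero]
    exact pow_lt_one₀ (by positivity) ((div_lt_one hpos).2 hdiff) two_ne_zero
  have hunit : (z.re / ‖z‖) ^ 2 + (z.im / ‖z‖) ^ 2 = 1 := by
    rw [div_pow, div_pow, ← add_div, div_eq_one_iff_eq (pow_ne_zero 2 hz0.ne'), Complex.sq_norm,
      Complex.normSq_apply, sq, sq]
  change _ < (1 : ℝ)
  rw [joukowski_re, joukowski_im, mul_div_right_comm, mul_div_right_comm, mul_pow, mul_pow,
    mul_comm, mul_comm _ ((z.im / ‖z‖) ^ 2)]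
  exact convex_Iio (1 : ℝ) hre him (sq_nonneg _) (sq_nonneg _) hunit

theorem ofReal_mem_insideBernsteinEllipse {ρ : ℝ} (hρ : 1 < ρ) {x : ℝ}
    (hx : x ∈ Set.Icc (-1 : ℝ) 1) : (x : ℂ) ∈ insideBernsteinEllipse ρ := by
  obtain ⟨z, hz⟩ := exists_circle_joukowski_eq hx
  rw [← hz]
  exact joukowski_mem_insideBernsteinEllipse z.norm_coe.ge (z.norm_coe.trans_lt hρ)

theorem two_mul_eval_T_joukowski {z : ℂ} (hz : z ≠ 0) (n : ℕ) :
    2 * (Chebyshev.T ℂ n).eval (joukowski z) = z ^ n + z⁻¹ ^ n := by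
  have hC := congrArg (eval (joukowski z)) (Chebyshev.C_comp_two_mul_X ℂ n)
  rw [← dickson_one_one_eval_add_inv z z⁻¹ (mul_inv_cancel₀ hz), dickson_one_one_eq_chebyshev_C]
  simpa [joukowski, mul_div_cancel₀] using hC.symm

section CircleAverage

variable {E : Type*} [NormedAddCommGroup E]

theorem norm_circleAverage_le [NormedSpace ℝ E] {g : ℂ → E} {a : ℂ} {R B : ℝ}
    (hg : ∀ z ∈ Metric.sphere a |R|, ‖g z‖ ≤ B) : ‖Real.circleAverage g a R‖ ≤ B := by
  have hint := intervalIntegral.norm_integral_le_of_norm_le_const (a := 0) (b := 2 * Real.pi)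
    fun θ _ => hg _ (circleMap_mem_sphere' a R θ)
  rw [sub_zero, abs_of_pos Real.two_pi_pos] at hint
  rw [Real.circleAverage, norm_smul, norm_inv, Real.norm_of_nonneg Real.two_pi_pos.le,
    inv_mul_le_iff₀ Real.two_pi_pos]
  exact hint.trans_eq (mul_comm _ _)

variable [NormedSpace ℂ E]

theorem circleAverage_eq_of_differentiableAt_annulus {g : ℂ → E} {a : ℂ}
    {r R : ℝ} (hr : 0 < r) (hrR : r ≤ R)
    (hg : ∀ z, r ≤ ‖z - a‖ → ‖z - a‖ ≤ R → DifferentiableAt ℂ g z) :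
    Real.circleAverage g a R = Real.circleAverage g a r := by
  rw [Real.circleAverage_eq_circleIntegral hr.ne',
    Real.circleAverage_eq_circleIntegral (hr.trans_le hrR).ne']
  congr 1
  refine Complex.circleIntegral_sub_center_inv_smul_eq_of_differentiable_on_annulus_off_countable
    hr hrR Set.countable_empty (fun z hz => ?_) fun z hz => ?_
  · simp only [Set.mem_sdiff, Metric.mem_closedBall, Metric.mem_ball, dist_eq_norm, not_lt] at hz
    exact (hg z hz.2 hz.1).continuousAt.continuousWithinAt
  · simp only [Set.mem_sdiff, Metric.mem_closedBall, Metric.mem_ball, dist_eq_norm, not_le,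
      Set.mem_empty_iff_false, not_false_eq_true, and_true] at hz
    exact hg z hz.2.le hz.1.le

variable {T : ℝ} [Fact (0 < T)]

theorem fourierCoeff_comp_toCircle (g : ℂ → E) (n : ℤ) :
    fourierCoeff (fun t : AddCircle T => g t.toCircle) n =
      Real.circleAverage (fun z => z ^ (-n) • g z) 0 1 := by
  have hT : T ≠ 0 := (Fact.out : 0 < T).ne'
  have hcircle : ∀ t : ℝ, (AddCircle.toCircle (t : AddCircle T) : ℂ) =
      circleMap 0 1 (2 * Real.pi / T * t) := by
    intro t
    rw [AddCircle.toCircle_apply_mk, Circle.coe_exp, circleMap_zero, Complex.ofReal_one, one_mul]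
  have hsubst := intervalIntegral.integral_comp_mul_left (a := 0) (b := T)
    (fun θ => circleMap 0 1 θ ^ (-n) • g (circleMap 0 1 θ))
    (div_ne_zero Real.two_pi_pos.ne' hT)
  rw [mul_zero, div_mul_cancel₀ _ hT] at hsubst
  rw [fourierCoeff_eq_intervalIntegral _ n 0, zero_add, Real.circleAverage]
  simp only [fourier_apply, AddCircle.toCircle_zsmul, Circle.coe_zpow, hcircle, hsubst, smul_smul]
  congr 1
  field_simp

theorem norm_fourierCoeff_comp_toCircle_le {g : ℂ → E} {R M : ℝ} (hR : 1 < R)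
    (hg : ∀ z, 1 ≤ ‖z‖ → ‖z‖ < R → DifferentiableAt ℂ g z)
    (hM : ∀ z, 1 ≤ ‖z‖ → ‖z‖ < R → ‖g z‖ ≤ M) (n : ℤ) :
    ‖fourierCoeff (fun t : AddCircle T => g t.toCircle) n‖ ≤ M * R ^ (-n) := by
  have hR0 : R ≠ 0 := (one_pos.trans hR).ne'
  have hle : ∀ r ∈ Set.Ioo 1 R,
      ‖fourierCoeff (fun t : AddCircle T => g t.toCircle) n‖ ≤ M * r ^ (-n) := by
    intro r ⟨hr1, hrR⟩
    have hr0 : 0 < r := one_pos.trans hr1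
    rw [fourierCoeff_comp_toCircle,
      ← circleAverage_eq_of_differentiableAt_annulus one_pos hr1.le fun z hz1 hzr => ?_]
    · refine norm_circleAverage_le fun z hz => ?_
      have hzr : ‖z‖ = r := by rwa [mem_sphere_zero_iff_norm, abs_of_pos hr0] at hz
      rw [norm_smul, norm_zpow, hzr, mul_comm]
      exact mul_le_mul_of_nonneg_right (hM z (hzr ▸ hr1.le) (hzr ▸ hrR)) (by positivity)
    · rw [sub_zero] at hz1 hzr
      exact (differentiableAt_zpow.2 (.inl (norm_pos_iff.1 (one_pos.trans_le hz1)))).smul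
        (hg z hz1 (hzr.trans_lt hrR))
  have hlim : Filter.Tendsto (fun r : ℝ => M * r ^ (-n)) (nhdsWithin R (Set.Iio R))
      (nhds (M * R ^ (-n))) :=
    (continuousAt_const.mul (continuousAt_zpow₀ R (-n) (.inl hR0))).tendsto.mono_left
      nhdsWithin_le_nhds
  exact ge_of_tendsto hlim (Filter.mem_of_superset (Ioo_mem_nhdsLT hR) hle)

end CircleAverage

/-! ### Chebyshev series -/

section ChebyshevSeries

variable {T : ℝ} [Fact (0 < T)]

theorem fourierCoeff_neg_of_even {E : Type*} [NormedAddCommGroup E] [NormedSpace ℂ E]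
    {F : AddCircle T → E} (hF : ∀ t, F (-t) = F t) (n : ℤ) :
    fourierCoeff F (-n) = fourierCoeff F n := by
  rw [fourierCoeff, fourierCoeff, ← MeasureTheory.integral_neg_eq_self]
  congr 1
  ext t
  rw [hF, fourier_apply, fourier_apply, neg_neg, smul_neg, neg_smul]

/-- The coefficients of the cosine series of `F`, the one of index `0` being already halved; for an
even `F` they are the Chebyshev coefficients of the function `g` on `[-1, 1]` with
`F t = g (joukowski t.toCircle)`. -/
noncomputable def chebyshevCoeff (F : AddCircle T → ℂ) (k : ℕ) : ℂ :=
  if k = 0 then fourierCoeff F 0 else 2 * fourierCoeff F k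

theorem norm_chebyshevCoeff_le {F : AddCircle T → ℂ} {k : ℕ} {B : ℝ} (hB : ‖fourierCoeff F k‖ ≤ B) :
    ‖chebyshevCoeff F k‖ ≤ 2 * B := by
  rw [chebyshevCoeff]
  split_ifs with hk
  · subst hk
    exact hB.trans (le_mul_of_one_le_left ((norm_nonneg _).trans hB) one_le_two)
  · rw [norm_mul, Complex.norm_ofNat]
    exact mul_le_mul_of_nonneg_left hB zero_le_two

theorem hasSum_chebyshevCoeff_mul {F : C(AddCircle T, ℂ)} (hF : ∀ t, F (-t) = F t)
    (hsum : Summable (fourierCoeff F)) (t : AddCircle T) :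
    HasSum (fun k : ℕ => chebyshevCoeff F k * (Chebyshev.T ℂ k).eval (joukowski t.toCircle))
      (F t) := by
  have hterm : ∀ k : ℕ, fourierCoeff F k • fourier k t + fourierCoeff F (-k) • fourier (-k) t -
      (if k = 0 then fourierCoeff F 0 else 0) =
        chebyshevCoeff F k * (Chebyshev.T ℂ k).eval (joukowski t.toCircle) := by
    intro k
    rw [fourierCoeff_neg_of_even hF, ← smul_add, chebyshevCoeff]
    split_ifs with hk
    · simp [hk, mul_add]
    · rw [sub_zero, mul_right_comm, two_mul_eval_T_joukowski t.toCircle.coe_ne_zero]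
      simp only [fourier_apply, AddCircle.toCircle_zsmul, smul_eq_mul, zpow_neg, zpow_natCast,
        Circle.coe_inv, Circle.coe_pow, inv_pow, mul_comm]
  have hlim : F t + fourierCoeff F 0 • fourier 0 t - fourierCoeff F 0 = F t := by
    rw [fourier_zero, smul_eq_mul, mul_one, add_sub_cancel_right]
  simpa only [hterm, hlim] using
    (has_pointwise_sum_fourier_series_of_summable hsum t).nat_add_neg.sub
      (hasSum_ite_eq 0 (fourierCoeff F 0))

end ChebyshevSeries

theorem exists_hasSum_chebyshev {ρ M : ℝ} {f : ℂ → ℂ} (hρ : 1 < ρ)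
    (hf : AnalyticOnNhd ℂ f (insideBernsteinEllipse ρ))
    (hM : ∀ z ∈ insideBernsteinEllipse ρ, ‖f z‖ ≤ M) :
    ∃ a : ℕ → ℂ, (∀ k, ‖a k‖ ≤ 2 * (M * ρ⁻¹ ^ k)) ∧ ∀ x ∈ Set.Icc (-1 : ℝ) 1,
      HasSum (fun k => a k * (Chebyshev.T ℂ k).eval (x : ℂ)) (f x) := by
  have hdiff : ∀ z, 1 ≤ ‖z‖ → ‖z‖ < ρ → DifferentiableAt ℂ (fun z => f (joukowski z)) z :=
    fun z hz hzρ => (hf _ (joukowski_mem_insideBernsteinEllipse hz hzρ)).differentiableAt.comp z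
      (differentiableAt_joukowski (norm_pos_iff.1 (one_pos.trans_le hz)))
  have hcont : Continuous fun t : UnitAddCircle => f (joukowski t.toCircle) :=
    continuous_iff_continuousAt.2 fun t => ContinuousAt.comp
      (f := fun t : UnitAddCircle => (t.toCircle : ℂ)) (g := fun z => f (joukowski z))
      (hdiff _ t.toCircle.norm_coe.ge (t.toCircle.norm_coe.trans_lt hρ)).continuousAt
      (continuous_subtype_val.comp AddCircle.continuous_toCircle).continuousAt
  let F : C(UnitAddCircle, ℂ) := ⟨fun t => f (joukowski t.toCircle), hcont⟩
  have heven : ∀ t, F (-t) = F t := fun t =>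
    congrArg f (by rw [AddCircle.toCircle_neg, Circle.coe_inv, joukowski_inv])
  have hbound : ∀ k : ℕ, ‖fourierCoeff F k‖ ≤ M * ρ⁻¹ ^ k := fun k => by
    rw [inv_pow, ← zpow_natCast, ← zpow_neg]
    exact norm_fourierCoeff_comp_toCircle_le hρ hdiff
      (fun z hz hzρ => hM _ (joukowski_mem_insideBernsteinEllipse hz hzρ)) k
  have hnat : Summable fun k : ℕ => fourierCoeff F k :=
    .of_norm_bounded ((summable_geometric_of_lt_one (by positivity)
      (inv_lt_one_of_one_lt₀ hρ)).mul_left M) hbound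
  have hsum : Summable (fourierCoeff F) :=
    hnat.of_nat_of_neg (by simpa only [fourierCoeff_neg_of_even heven] using hnat)
  refine ⟨chebyshevCoeff F, fun k => norm_chebyshevCoeff_le (hbound k), fun x hx => ?_⟩
  obtain ⟨z, hz⟩ := exists_circle_joukowski_eq hx
  obtain ⟨t, rfl⟩ := (AddCircle.homeomorphCircle one_ne_zero).surjective z
  rw [AddCircle.homeomorphCircle_apply] at hz
  have hFt : F t = f x := congrArg f hz
  simpa only [hFt, hz] using hasSum_chebyshevCoeff_mul heven hsum t

theorem exists_polynomial_norm_sub_eval_le {ρ M : ℝ} {f : ℂ → ℂ} (hρ : 1 < ρ)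
    (hf : AnalyticOnNhd ℂ f (insideBernsteinEllipse ρ))
    (hM : ∀ z ∈ insideBernsteinEllipse ρ, ‖f z‖ ≤ M) (n : ℕ) :
    ∃ p : ℂ[X], p.degree < n ∧ ∀ x ∈ Set.Icc (-1 : ℝ) 1,
      ‖f x - p.eval (x : ℂ)‖ ≤ 2 * M * ρ⁻¹ ^ n / (1 - ρ⁻¹) := by
  obtain ⟨a, ha, hsum⟩ := exists_hasSum_chebyshev hρ hf hM
  refine ⟨∑ k ∈ Finset.range n, C (a k) * Chebyshev.T ℂ k, ?_, fun x hx => ?_⟩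
  · refine mem_degreeLT.1 (Submodule.sum_mem _ fun k hk => ?_)
    rw [← smul_eq_C_mul]
    refine Submodule.smul_mem _ _ (mem_degreeLT.2 ?_)
    rw [Chebyshev.degree_T, Int.natAbs_natCast]
    exact_mod_cast Finset.mem_range.1 hk
  · have hterm : ∀ k : ℕ, ‖a k * (Chebyshev.T ℂ k).eval (x : ℂ)‖ ≤ 2 * M * ρ⁻¹ ^ k := by
      intro k
      rw [norm_mul, mul_assoc 2 M, ← Chebyshev.complex_ofReal_eval_T, Complex.norm_real]
      exact (mul_le_of_le_one_right (norm_nonneg _)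
        (Chebyshev.abs_eval_T_real_le_one k (abs_le.2 hx))).trans (ha k)
    rw [norm_sub_rev, eval_finsetSum]
    simp only [eval_mul, eval_C]
    exact norm_sub_le_of_geometric_bound_of_hasSum (inv_lt_one_of_one_lt₀ hρ) hterm (hsum x hx) n

theorem zpow_div_sub_one_eq {K : Type*} [Field K] {ρ : K} (hρ : ρ ≠ 0) (n : ℕ) :
    ρ ^ (-n + 1 : ℤ) / (ρ - 1) = ρ⁻¹ ^ n / (1 - ρ⁻¹) := by
  rw [zpow_add_one₀ hρ, zpow_neg, zpow_natCast, inv_pow, mul_div_assoc]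
  field_simp

theorem mainTheorem8 (ρ : ℝ) (hρ : 1 < ρ) (M : ℝ) (f : ℂ → ℂ)
    (hf : AnalyticOnNhd ℂ f (insideBernsteinEllipse ρ))
    (hM : ∀ z ∈ insideBernsteinEllipse ρ, ‖f z‖ ≤ M)
    (w : ℝ → ℝ) (hw : IsWeight w) (Q : ℕ) (hQ : 1 ≤ Q) :
    (∃ x c : Fin Q → ℝ, IsGaussRule w Q x c) ∧
    ∀ x c : Fin Q → ℝ, IsGaussRule w Q x c →
      (∀ j, x j ∈ Set.Ioo (-1 : ℝ) 1) ∧ (∀ j, 0 < c j) ∧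
      ‖(∫ t in (-1 : ℝ)..1, (w t : ℂ) * f (t : ℂ)) - ∑ j, (c j : ℂ) * f (x j : ℂ)‖ ≤
        4 * M * (ρ ^ (-2 * (Q : ℤ) + 1) / (ρ - 1)) * ∫ t in (-1 : ℝ)..1, w t := by
  refine ⟨hw.exists_isGaussRule Q, fun x c h => ⟨h.mem_Ioo hw, h.weight_pos hw, ?_⟩⟩
  have hcont : ContinuousOn (fun t : ℝ => f t) (Set.Icc (-1) 1) := fun t ht =>
    ((hf _ (ofReal_mem_insideBernsteinEllipse hρ ht)).continuousAt.comp
      Complex.continuous_ofReal.continuousAt).continuousWithinAt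
  obtain ⟨p, hp, hE⟩ := exists_polynomial_norm_sub_eval_le hρ hf hM (2 * Q)
  have hconst : ρ ^ (-2 * (Q : ℤ) + 1) / (ρ - 1) = ρ⁻¹ ^ (2 * Q) / (1 - ρ⁻¹) := by
    rw [← zpow_div_sub_one_eq (one_pos.trans hρ).ne']
    push_cast
    rw [neg_mul]
  refine (h.norm_error_le hw hQ hcont hp hE).trans_eq ?_
  rw [hconst]
  ring
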